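/- \textbf{Setting.} For $n\ge 2$, $\mu>0$ and $p\in[0,1]$ let $(X_t,\eta_t)_{t\ge 0}$ be the continuous-time Markov chain of a random walk on dynamical percolation on the complete graph $K_n$ with vertex set $\{1,\dots,n\}$ and edge set $E$. Each edge carries an independent rate-$\mu$ clock; when it rings, the state of that edge is refreshed: it is declared open ($\eta(e)=1$) with probability $p$ and closed ($\eta(e)=0$) with probability $1-p$. The walker has an independent rate-$1$ clock; when it rings, the walker chooses one of the $n-1$ other vertices uniformly at random and jumps there if and only if the connecting edge is open at that time, otherwise it stays put. Let $\pi_{\mathrm{ER}}$ be the product measure on $\{0,1\}^E$ with density $p$, let $\pi_U$ be the uniform distribution on $\{1,\dots,n\}$, and let $\mathbb P_{1,\mathrm{ER}}$ be the law of the chain with $X_0=1$ and $\eta_0\sim\pi_{\mathrm{ER}}$. For $\epsilon\in(0,1)$ put \[ t^{\mathrm{RW}}_{\mathrm{mix}}(\epsilon)=\sup\bigl\{t\ge 0 \;:\; \|\mathbb P_{1,\mathrm{ER}}(X_t\in\cdot)-\pi_U\|_{\mathrm{TV}}\ge\epsilon\bigr\}\in[0,\infty]\qquad(\sup\emptyset=0).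 \] \textbf{Theorem.} For every $\lambda>0$ there is a constant $C=C(\lambda)>0$ such that for every $\epsilon\in(0,1)$ there is $N=N(\lambda,\epsilon)$ such that for all $n\ge N$ and all $\mu>0$, with $p=\lambda/n$, both of the following hold. \begin{enumerate} \item If $\epsilon<\min(e^{-3\lambda},1)$, then $\displaystyle t^{\mathrm{RW}}_{\mathrm{mix}}(\epsilon)\ge \frac1\mu\cdot\frac{1}{2\lambda}\log(1/\epsilon)$. \item If $\epsilon<\tfrac14$ and $\mu\le \tfrac23(1+\lambda)^{-1}/n$, then $\displaystyle t^{\mathrm{RW}}_{\mathrm{mix}}(\epsilon)\le \frac1\mu\cdot C\log(1/\epsilon)$. \end{enumerate} -/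

import Mathlib

open scoped BigOperators ENNReal

noncomputable section

namespace DynamicalER

/-- The edge set of the complete graph `K_n` on the vertex set `Fin n` (unordered pairs of
distinct vertices). -/
abbrev Edge (n : ℕ) : Type := (⊤ : SimpleGraph (Fin n)).edgeSet

/-- A percolation environment: `true` is an open edge, `false` a closed one. -/
abbrev Env (n : ℕ) : Type := Edge n → Bool

/-- A state of the full system: the location of the walker and the environment. -/
abbrev State (n : ℕ) : Type := Fin n × Env n

/-- The edge of `K_n` joining two distinct vertices. -/
def edge {n : ℕ} (x v : Fin n) (h : x ≠ v) : Edge n := ⟨s(x, v), by simpa using h⟩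

/-- The location of the walker at `x` after it has tried to cross the edge to `v`: it jumps to `v`
if that edge is open, and stays at `x` otherwise. -/
def walkerAfter {n : ℕ} (η : Env n) (x v : Fin n) : Fin n :=
  if h : x ≠ v then (if η (edge x v h) = true then v else x) else x

/-- The indicator that the state `b` equals the state `a`. -/
def pointMass {n : ℕ} (a b : State n) : ℝ := if b = a then 1 else 0

/-- The generator (`Q`-matrix) of the full system `(X, η)` on `K_n`, as the sum over all clocks of
rate times (transition kernel at a ring minus identity).
The walker's clock has rate `1`; at a ring a vertex `v ≠ x` is chosen uniformly at random and the
walker moves there if the edge is open. Each edge has a clock of rate `μ`; at a ring the edge is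
declared open with probability `p` and closed with probability `1 - p`. -/
def generator (n : ℕ) (μ p : ℝ) : Matrix (State n) (State n) ℝ :=
  Matrix.of fun a b =>
    (∑ v ∈ Finset.univ.erase a.1,
      1 / ((n : ℝ) - 1) * (pointMass (walkerAfter a.2 a.1 v, a.2) b - pointMass a b)) +
    ∑ e : Edge n,
      μ * (p * pointMass (a.1, Function.update a.2 e true) b +
        (1 - p) * pointMass (a.1, Function.update a.2 e false) b - pointMass a b)

/-- `transition n μ p t (x₀, η₀) (x, η)` is the probability that the full system, started from
`(x₀, η₀)`, is in the state `(x, η)` at time `t`. -/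
def transition (n : ℕ) (μ p t : ℝ) : Matrix (State n) (State n) ℝ :=
  NormedSpace.exp (t • generator n μ p)

/-- The Erdős–Rényi measure: the product measure on environments with density `p`. -/
def erdosRenyi (n : ℕ) (p : ℝ) (η : Env n) : ℝ :=
  ∏ e : Edge n, if η e = true then p else 1 - p

/-- The law of `X_t` when the walk starts from `x₀` and the initial environment is drawn from the
Erdős–Rényi measure, independently of `x₀`. -/
def walkLaw (n : ℕ) (μ p : ℝ) (x₀ : Fin n) (t : ℝ) (x : Fin n) : ℝ :=
  ∑ η₀ : Env n, erdosRenyi n p η₀ * ∑ η : Env n, transition n μ p t (x₀, η₀) (x, η)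

/-- The total variation distance between two probability mass functions on `Fin n`. -/
def tvDist {n : ℕ} (f g : Fin n → ℝ) : ℝ := (1 / 2) * ∑ x : Fin n, |f x - g x|

/-- The uniform distribution on `Fin n`. -/
def uniformLaw (n : ℕ) : Fin n → ℝ := fun _ => 1 / (n : ℝ)

/-- The mixing time of the random walk component: the supremum in `[0, ∞]` of the times `t ≥ 0`
at which the law of `X_t` is at total variation distance at least `ε` from uniform. -/
def tMixRW (n : ℕ) (μ p : ℝ) (x₀ : Fin n) (ε : ℝ) : ℝ≥0∞ :=
  ⨆ t ∈ {t : ℝ | 0 ≤ t ∧ ε ≤ tvDist (walkLaw n μ p x₀ t) (uniformLaw n)}, ENNReal.ofReal t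

end DynamicalER

end

/-!
Permuting the vertices of `K_n` preserves the dynamics, so the law of the walker started from `x₀`
is constant off `x₀`, and its total variation distance from uniform is exactly `|q t - 1 / n|`,
where `q t` is the return probability (`tvDist_walkLaw`). Both bounds are therefore bounds on `q`.

*Lower bound.* With positive probability no edge at `x₀` is open initially, and up to time `t`
none is refreshed to open with probability at least `exp (-λ μ t)`; until then the walker cannot
move. In terms of the generator `Q`, the indicator `f` of an isolated walker satisfies
`Q f ≥ -μ λ f`, and positivity of the semigroup gives `q t ≥ exp (-λ μ t) (1 - λ / n) ^ n`
(`exp_mul_pow_le_walkLaw`).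

*Upper bound.* Let `u t` be the semigroup applied to `1_{X = x₀} - 1 / n`, and let `G t` be the
sum over all vertices `x` of the second moment of `u t (x, ·)` under the Erdős–Rényi measure.
Since `q t - 1 / n` is the mean of `u t (x₀, ·)`, its square is at most `G t`, while `G 0 ≤ 1`.
The system is reversible, so `G' = -2 𝓔(u)` for the Dirichlet form `𝓔`
(`sum_erExpect_mul_generator`). The walk in a frozen environment is doubly stochastic, hence `u t`
sums to zero over the vertices in *every* environment, and for such functions a Poincaré
inequality `𝓔(u) ≥ (μ λ / 6) G` holds (`poincare`): the difference of `u` across a closed edge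
`x v` is estimated along the path that opens the edge, crosses it, and closes it again
(`erExpect_sq_sub_le`). The opening and closing steps are weighted by `μ p` and the crossing step
by `p / (n - 1) ≥ μ p`, which is where the bound on `μ` enters. Starting from `n` times a point
mass, an `L²` bound would usually cost a factor `log n`; here the reduction to the return
probability removes it. So `|q t - 1 / n| ≤ exp (-μ λ t / 6)`, and `C = 6 / λ` works.
-/

namespace DynamicalER

open scoped Matrix

/-! ### Product Bernoulli expectations -/

/-- The expectation of `F` under the Erdős–Rényi measure of density `p`. -/
noncomputable def erExpect (n : ℕ) (p : ℝ) (F : Env n → ℝ) : ℝ :=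
  ∑ η : Env n, erdosRenyi n p η * F η

section Expectation

variable {n : ℕ} {p : ℝ}

theorem erdosRenyi_nonneg (hp0 : 0 ≤ p) (hp1 : p ≤ 1) (η : Env n) : 0 ≤ erdosRenyi n p η :=
  Finset.prod_nonneg fun e _ => by split_ifs <;> linarith

theorem erExpect_prod (g : Edge n → Bool → ℝ) :
    erExpect n p (fun η => ∏ e, g e (η e)) = ∏ e, (p * g e true + (1 - p) * g e false) := by
  have h := Fintype.prod_sum (fun (e : Edge n) (b : Bool) => (if b = true then p else 1 - p) * g e b)
  simp only [Fintype.sum_bool, Bool.false_eq_true, if_true, if_false] at h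
  rw [h, erExpect]
  exact Finset.sum_congr rfl fun η _ => by rw [erdosRenyi, Finset.prod_mul_distrib]

theorem erExpect_const (c : ℝ) : erExpect n p (fun _ => c) = c := by
  have h := erExpect_prod (n := n) (p := p) (fun _ _ => 1)
  simp only [erExpect, Finset.prod_const_one, mul_one, add_sub_cancel] at h
  rw [erExpect, ← Finset.sum_mul, h, one_mul]

theorem erExpect_mono (hp0 : 0 ≤ p) (hp1 : p ≤ 1) {F G : Env n → ℝ} (h : ∀ η, F η ≤ G η) :
    erExpect n p F ≤ erExpect n p G :=
  Finset.sum_le_sum fun η _ => mul_le_mul_of_nonneg_left (h η) (erdosRenyi_nonneg hp0 hp1 η)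

theorem erExpect_add (F G : Env n → ℝ) :
    erExpect n p (fun η => F η + G η) = erExpect n p F + erExpect n p G := by
  simp only [erExpect, mul_add, Finset.sum_add_distrib]

theorem erExpect_const_mul (c : ℝ) (F : Env n → ℝ) :
    erExpect n p (fun η => c * F η) = c * erExpect n p F := by
  simp only [erExpect, Finset.mul_sum, mul_left_comm]

theorem erExpect_sum {ι : Type*} (s : Finset ι) (F : ι → Env n → ℝ) :
    erExpect n p (fun η => ∑ i ∈ s, F i η) = ∑ i ∈ s, erExpect n p (F i) := by
  simp only [erExpect, Finset.mul_sum]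
  exact Finset.sum_comm

/-- Stationarity of the Erdős–Rényi measure under refreshing a single edge. -/
theorem erExpect_resample (e : Edge n) (F : Env n → ℝ) :
    erExpect n p F = erExpect n p (fun η =>
      p * F (Function.update η e true) + (1 - p) * F (Function.update η e false)) := by
  classical
  have key : ∀ G : Env n → ℝ, erExpect n p G =
      ∑ ξ : ({e' // e' ≠ e} → Bool),
        (∏ e', if ξ e' = true then p else 1 - p) *
          (p * G ((Equiv.funSplitAt e Bool).symm (true, ξ)) +
            (1 - p) * G ((Equiv.funSplitAt e Bool).symm (false, ξ))) := by
    intro G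
    have hw : ∀ b ξ, erdosRenyi n p ((Equiv.funSplitAt e Bool).symm (b, ξ)) =
        (if b = true then p else 1 - p) * ∏ e', if ξ e' = true then p else 1 - p := by
      intro b ξ
      rw [erdosRenyi, Fintype.prod_eq_mul_prod_subtype_ne _ e]
      congr 1
      · simp
      · refine Finset.prod_congr rfl fun e' _ => ?_
        simp [e'.2]
    rw [erExpect, ← (Equiv.funSplitAt e Bool).symm.sum_comp, Fintype.sum_prod_type_right]
    refine Finset.sum_congr rfl fun ξ _ => ?_
    simp only [Fintype.sum_bool, hw, if_true, Bool.false_eq_true, if_false]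
    ring
  have hu : ∀ b c ξ, Function.update ((Equiv.funSplitAt e Bool).symm (b, ξ)) e c =
      (Equiv.funSplitAt e Bool).symm (c, ξ) := by
    intro b c ξ
    funext e'
    by_cases h : e' = e
    · subst h; simp
    · simp [h]
  rw [key, key]
  refine Finset.sum_congr rfl fun ξ _ => ?_
  simp only [hu]
  ring

end Expectation

/-! ### The generator and its Dirichlet form -/

/-- The indicator that `x` and `v` are distinct and joined by an open edge of `η`. -/
noncomputable def openInd {n : ℕ} (η : Env n) (x v : Fin n) : ℝ :=
  if h : x ≠ v then (if η (edge x v h) = true then 1 else 0) else 0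

section Dirichlet

variable {n : ℕ} {μ p : ℝ}

theorem edge_comm {x v : Fin n} (h : x ≠ v) : edge x v h = edge v x h.symm :=
  Subtype.ext Sym2.eq_swap

theorem edge_injective {x v w : Fin n} (hv : x ≠ v) (hw : x ≠ w)
    (h : edge x v hv = edge x w hw) : v = w :=
  Sym2.congr_right.1 (congrArg Subtype.val h)

theorem openInd_nonneg (η : Env n) (x v : Fin n) : 0 ≤ openInd η x v := by
  unfold openInd; split_ifs <;> norm_num

theorem openInd_comm (η : Env n) (x v : Fin n) : openInd η x v = openInd η v x := by
  unfold openInd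
  by_cases h : x ≠ v
  · rw [dif_pos h, dif_pos h.symm, edge_comm h]
  · rw [dif_neg h, dif_neg fun h' => h h'.symm]

theorem openInd_update (η : Env n) {x v : Fin n} (h : x ≠ v) (b : Bool) :
    openInd (Function.update η (edge x v h) b) x v = if b = true then 1 else 0 := by
  rw [openInd, dif_pos h, Function.update_self]

theorem apply_walkerAfter_sub (f : State n → ℝ) (η : Env n) (x v : Fin n) :
    f (walkerAfter η x v, η) - f (x, η) = openInd η x v * (f (v, η) - f (x, η)) := by
  unfold walkerAfter openInd
  split_ifs <;> simp

theorem sum_pointMass_mul (a : State n) (f : State n → ℝ) : ∑ b, pointMass a b * f b = f a := by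
  simp [pointMass]

theorem generator_mulVec (f : State n → ℝ) (x : Fin n) (η : Env n) :
    (generator n μ p *ᵥ f) (x, η) =
      ∑ v, 1 / ((n : ℝ) - 1) * (openInd η x v * (f (v, η) - f (x, η))) +
      ∑ e : Edge n, μ * (p * f (x, Function.update η e true) +
        (1 - p) * f (x, Function.update η e false) - f (x, η)) := by
  have h0 : ∀ v, v ∉ Finset.univ.erase x →
      1 / ((n : ℝ) - 1) * (openInd η x v * (f (v, η) - f (x, η))) = 0 := by
    intro v hv
    obtain rfl : v = x := by simpa using hv
    simp
  rw [← Finset.sum_subset (Finset.subset_univ (Finset.univ.erase x)) fun v _ => h0 v]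
  simp only [← apply_walkerAfter_sub, Matrix.mulVec, dotProduct, generator, Matrix.of_apply,
    add_mul, Finset.sum_mul, Finset.sum_add_distrib]
  congr 1
  · rw [Finset.sum_comm]
    refine Finset.sum_congr rfl fun v _ => ?_
    simp only [mul_assoc, ← Finset.mul_sum, sub_mul, Finset.sum_sub_distrib, sum_pointMass_mul]
  · rw [Finset.sum_comm]
    refine Finset.sum_congr rfl fun e _ => ?_
    simp only [mul_assoc, ← Finset.mul_sum, sub_mul, add_mul, Finset.sum_sub_distrib,
      Finset.sum_add_distrib, sum_pointMass_mul]

/-- The Dirichlet form of the full system, with respect to counting measure on the vertices times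
the Erdős–Rényi measure on the environments. -/
noncomputable def dirichletForm (n : ℕ) (μ p : ℝ) (f : State n → ℝ) : ℝ :=
  1 / 2 * ∑ x, ∑ v, 1 / ((n : ℝ) - 1) *
      erExpect n p (fun η => openInd η x v * (f (v, η) - f (x, η)) ^ 2) +
    ∑ x, ∑ e : Edge n, μ * (p * (1 - p) * erExpect n p (fun η =>
      (f (x, Function.update η e true) - f (x, Function.update η e false)) ^ 2))

theorem sum_erExpect_mul_generator (f : State n → ℝ) :
    ∑ x, erExpect n p (fun η => f (x, η) * (generator n μ p *ᵥ f) (x, η)) =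
      -dirichletForm n μ p f := by
  -- Symmetrize over the ordered pairs `(x, v)`.
  have hwalk : ∑ x, ∑ v, 1 / ((n : ℝ) - 1) *
        erExpect n p (fun η => f (x, η) * (openInd η x v * (f (v, η) - f (x, η)))) =
      -(1 / 2 * ∑ x, ∑ v, 1 / ((n : ℝ) - 1) *
        erExpect n p (fun η => openInd η x v * (f (v, η) - f (x, η)) ^ 2)) := by
    set S := ∑ x, ∑ v, 1 / ((n : ℝ) - 1) *
        erExpect n p (fun η => f (x, η) * (openInd η x v * (f (v, η) - f (x, η))))
    have hS : S = ∑ x, ∑ v, 1 / ((n : ℝ) - 1) *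
        erExpect n p (fun η => f (v, η) * (openInd η x v * (f (x, η) - f (v, η)))) := by
      refine Finset.sum_comm.trans (Finset.sum_congr rfl fun x _ =>
        Finset.sum_congr rfl fun v _ => ?_)
      simp only [openInd_comm _ v x]
    have h2 : S + S = -∑ x, ∑ v, 1 / ((n : ℝ) - 1) *
        erExpect n p (fun η => openInd η x v * (f (v, η) - f (x, η)) ^ 2) := by
      nth_rewrite 2 [hS]
      simp only [S, ← Finset.sum_add_distrib, ← Finset.sum_neg_distrib, ← mul_add, ← erExpect_add,
        ← mul_neg]
      refine Finset.sum_congr rfl fun x _ => Finset.sum_congr rfl fun v _ => ?_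
      rw [neg_eq_neg_one_mul (erExpect n p _), ← erExpect_const_mul (-1)]
      congr 2
      funext η
      ring
    linarith
  -- Resampling `e` makes the integrand explicit in the two states of `e`.
  have henv : ∀ x (e : Edge n), erExpect n p (fun η => f (x, η) *
        (p * f (x, Function.update η e true) +
          (1 - p) * f (x, Function.update η e false) - f (x, η))) =
      -(p * (1 - p) * erExpect n p (fun η =>
        (f (x, Function.update η e true) - f (x, Function.update η e false)) ^ 2)) := by
    intro x e
    rw [erExpect_resample e, ← neg_mul, ← erExpect_const_mul]
    congr 1
    funext η
    simp only [Function.update_idem]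
    ring
  rw [dirichletForm, neg_add, ← hwalk, ← Finset.sum_neg_distrib, ← Finset.sum_add_distrib]
  refine Finset.sum_congr rfl fun x _ => ?_
  simp only [generator_mulVec, mul_add, erExpect_add, Finset.mul_sum, erExpect_sum,
    mul_left_comm (f _), erExpect_const_mul]
  rw [← Finset.sum_neg_distrib]
  congr 1
  refine Finset.sum_congr rfl fun e _ => ?_
  rw [← mul_neg, ← henv]

/-- The one-edge comparison behind the Poincaré inequality. When `x v` is closed, the difference
`f v - f x` is controlled along the path that opens the edge, crosses it and closes it again; each
of the three steps is paid for by a term of the Dirichlet form. -/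
theorem erExpect_sq_sub_le (hμ : 0 ≤ μ) (hp0 : 0 ≤ p) (hp1 : p ≤ 1)
    (hμn : μ ≤ 1 / ((n : ℝ) - 1)) (f : State n → ℝ) {x v : Fin n} (h : x ≠ v) :
    μ * p / 6 * erExpect n p (fun η => (f (v, η) - f (x, η)) ^ 2) ≤
      1 / ((n : ℝ) - 1) * erExpect n p (fun η => openInd η x v * (f (v, η) - f (x, η)) ^ 2) +
      μ * (p * (1 - p) * erExpect n p (fun η =>
        (f (x, Function.update η (edge x v h) true) -
          f (x, Function.update η (edge x v h) false)) ^ 2)) +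
      μ * (p * (1 - p) * erExpect n p (fun η =>
        (f (v, Function.update η (edge x v h) true) -
          f (v, Function.update η (edge x v h) false)) ^ 2)) := by
  rw [erExpect_resample (edge x v h) (fun η => (f (v, η) - f (x, η)) ^ 2),
    erExpect_resample (edge x v h) (fun η => openInd η x v * (f (v, η) - f (x, η)) ^ 2)]
  simp only [openInd_update, if_true, Bool.false_eq_true, if_false]
  simp only [← mul_assoc, ← erExpect_const_mul, ← erExpect_add]
  refine erExpect_mono hp0 hp1 fun η => ?_
  generalize f (v, Function.update η (edge x v h) true) = v1
  generalize f (v, Function.update η (edge x v h) false) = v0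
  generalize f (x, Function.update η (edge x v h) true) = x1
  generalize f (x, Function.update η (edge x v h) false) = x0
  have hq : 0 ≤ 1 - p := by linarith
  have h1 : (v0 - x0) ^ 2 ≤ 3 * ((v1 - x1) ^ 2 + (x1 - x0) ^ 2 + (v1 - v0) ^ 2) := by
    nlinarith [sq_nonneg ((v1 - x1) - (x1 - x0)), sq_nonneg ((v1 - x1) + (v1 - v0)),
      sq_nonneg ((x1 - x0) + (v1 - v0))]
  have h2 : μ * (p * (v1 - x1) ^ 2) ≤ 1 / ((n : ℝ) - 1) * (p * (v1 - x1) ^ 2) :=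
    mul_le_mul_of_nonneg_right hμn (by positivity)
  have h3 : μ * p * (1 - p) * (v0 - x0) ^ 2 ≤
      μ * p * (1 - p) * (3 * ((v1 - x1) ^ 2 + (x1 - x0) ^ 2 + (v1 - v0) ^ 2)) :=
    mul_le_mul_of_nonneg_left h1 (by positivity)
  have h4 : 0 ≤ μ * p * (1 - p) * (x1 - x0) ^ 2 := by positivity
  have h5 : 0 ≤ μ * p * (1 - p) * (v1 - v0) ^ 2 := by positivity
  have h6 : 0 ≤ μ * p * p * (v1 - x1) ^ 2 := by positivity
  have h7 : 0 ≤ μ * p * (v1 - x1) ^ 2 := by positivity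
  linarith

/-- The Poincaré inequality for functions that have mean zero over the vertices in every
environment. -/
theorem poincare (hμ : 0 ≤ μ) (hp0 : 0 ≤ p) (hp1 : p ≤ 1) (hμn : μ ≤ 1 / ((n : ℝ) - 1))
    (f : State n → ℝ) (hf : ∀ η, ∑ x, f (x, η) = 0) :
    μ * p * n / 6 * ∑ x, erExpect n p (fun η => f (x, η) ^ 2) ≤ dirichletForm n μ p f := by
  classical
  -- `A x v` is the share of the environment part that comes from `x` and the edge `x v`. Summed over
  -- ordered pairs, `A x v + A v x` counts it twice, which the factor `1 / 2` of the walk part matches.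
  let A : Fin n → Fin n → ℝ := fun x v => if h : x ≠ v then
    μ * (p * (1 - p) * erExpect n p (fun η =>
        (f (x, Function.update η (edge x v h) true) -
          f (x, Function.update η (edge x v h) false)) ^ 2)) else 0
  have hA : ∀ x, ∑ v, A x v ≤ ∑ e : Edge n, μ * (p * (1 - p) * erExpect n p (fun η =>
      (f (x, Function.update η e true) - f (x, Function.update η e false)) ^ 2)) := by
    intro x
    set D : Edge n → ℝ := fun e => μ * (p * (1 - p) * erExpect n p (fun η =>
      (f (x, Function.update η e true) - f (x, Function.update η e false)) ^ 2))
    have hD : ∀ e, 0 ≤ D e := fun e => by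
      have h0 := erExpect_mono (n := n) hp0 hp1 (fun η => sq_nonneg
        (f (x, Function.update η e true) - f (x, Function.update η e false)))
      rw [erExpect_const] at h0
      have : 0 ≤ 1 - p := by linarith
      positivity
    calc ∑ v, A x v = ∑ v ∈ Finset.univ.filter (x ≠ ·), A x v := by
          refine (Finset.sum_filter_of_ne fun v _ hv => ?_).symm
          by_contra hx
          exact hv (dif_neg (not_not.2 hx))
      _ = ∑ v : {v // x ≠ v}, D (edge x v v.2) := by
          rw [← Finset.sum_subtype_eq_sum_filter, Finset.subtype_univ]
          exact Finset.sum_congr rfl fun v _ => dif_pos v.2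
      _ = ∑ e ∈ Finset.univ.image (fun v : {v // x ≠ v} => edge x v v.2), D e := by
          rw [Finset.sum_image]
          exact fun v _ w _ hvw => Subtype.ext (edge_injective v.2 w.2 hvw)
      _ ≤ ∑ e, D e :=
          Finset.sum_le_sum_of_subset_of_nonneg (Finset.subset_univ _) fun e _ _ => hD e
  have hpair : ∀ x v, μ * p / 6 * erExpect n p (fun η => (f (v, η) - f (x, η)) ^ 2) ≤
      1 / ((n : ℝ) - 1) * erExpect n p (fun η => openInd η x v * (f (v, η) - f (x, η)) ^ 2) +
        A x v + A v x := by
    intro x v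
    by_cases h : x = v
    · subst h
      simp [A, erExpect_const]
    · have := erExpect_sq_sub_le hμ hp0 hp1 hμn f h
      simp only [A]
      rwa [dif_pos h, dif_pos (Ne.symm h), ← edge_comm h]
  have hsq : ∑ x, ∑ v, erExpect n p (fun η => (f (v, η) - f (x, η)) ^ 2) =
      2 * n * ∑ x, erExpect n p (fun η => f (x, η) ^ 2) := by
    simp only [← erExpect_sum, ← erExpect_const_mul]
    congr 1
    funext η
    have : ∀ x, ∑ v, (f (v, η) - f (x, η)) ^ 2 =
        ∑ v, f (v, η) ^ 2 + n * f (x, η) ^ 2 := by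
      intro x
      calc ∑ v, (f (v, η) - f (x, η)) ^ 2
          = ∑ v, (f (v, η) ^ 2 + f (x, η) ^ 2 - 2 * f (x, η) * f (v, η)) :=
            Finset.sum_congr rfl fun v _ => by ring
        _ = _ := by
            rw [Finset.sum_sub_distrib, Finset.sum_add_distrib, ← Finset.mul_sum, hf]
            simp
    simp only [this, Finset.sum_add_distrib, ← Finset.mul_sum]
    simp
    ring
  have hsum := Finset.sum_le_sum fun x (_ : x ∈ Finset.univ) =>
    Finset.sum_le_sum fun v (_ : v ∈ Finset.univ) => hpair x v
  simp only [← Finset.mul_sum, Finset.sum_add_distrib, hsq] at hsum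
  rw [Finset.sum_comm (f := fun x v => A v x)] at hsum
  have hA' := Finset.sum_le_sum fun x (_ : x ∈ Finset.univ) => hA x
  rw [dirichletForm]
  simp only [← Finset.mul_sum] at hA' ⊢
  linarith

end Dirichlet

/-! ### The semigroup -/

/-- A closed convex cone that contains all powers of `M` contains `exp M`. -/
theorem exp_mem_of_pow_mem {A : Type*} [NormedRing A] [NormedAlgebra ℝ A] [CompleteSpace A]
    (C : AddSubmonoid A) (hC : IsClosed (C : Set A)) {M : A}
    (h : ∀ k : ℕ, ∀ c : ℝ, 0 ≤ c → c • M ^ k ∈ C) : NormedSpace.exp M ∈ C := by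
  rw [NormedSpace.exp_eq_tsum ℝ]
  exact tsum_mem hC fun k => h k _ (by positivity)

section Semigroup

open scoped Matrix.Norms.Operator

variable {ι : Type*} [Fintype ι] [DecidableEq ι]

theorem matrix_exp_mem_of_pow_mem (C : AddSubmonoid (Matrix ι ι ℝ))
    (hC : IsClosed (C : Set (Matrix ι ι ℝ))) {M : Matrix ι ι ℝ}
    (h : ∀ k : ℕ, ∀ c : ℝ, 0 ≤ c → c • M ^ k ∈ C) : NormedSpace.exp M ∈ C :=
  exp_mem_of_pow_mem C hC h

theorem hasDerivAt_exp_smul_mulVec (Q : Matrix ι ι ℝ) (f : ι → ℝ) (a : ι) (t : ℝ) :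
    HasDerivAt (fun t : ℝ => (NormedSpace.exp (t • Q) *ᵥ f) a)
      ((NormedSpace.exp (t • Q) *ᵥ (Q *ᵥ f)) a) t := by
  have h := hasDerivAt_exp_smul_const (𝕂 := ℝ) Q t
  let L : Matrix ι ι ℝ →ₗ[ℝ] ℝ :=
    { toFun := fun M => (M *ᵥ f) a
      map_add' := fun M N => by rw [Matrix.add_mulVec]; rfl
      map_smul' := fun c M => by rw [Matrix.smul_mulVec]; rfl }
  have h' := (LinearMap.toContinuousLinearMap L).hasFDerivAt.comp_hasDerivAt t h
  rw [Matrix.mulVec_mulVec]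
  exact h'

theorem exp_smul_mulVec_comm (Q : Matrix ι ι ℝ) (f : ι → ℝ) (t : ℝ) :
    NormedSpace.exp (t • Q) *ᵥ (Q *ᵥ f) = Q *ᵥ (NormedSpace.exp (t • Q) *ᵥ f) := by
  rw [Matrix.mulVec_mulVec, Matrix.mulVec_mulVec]
  congr 1
  exact (((Commute.refl Q).smul_left t).exp_left).eq

/-- The semigroup of a matrix with nonnegative off-diagonal entries is entrywise nonnegative. -/
theorem exp_smul_nonneg (Q : Matrix ι ι ℝ) (hQ : ∀ a b, a ≠ b → 0 ≤ Q a b) {t : ℝ} (ht : 0 ≤ t)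
    (a b : ι) : 0 ≤ NormedSpace.exp (t • Q) a b := by
  -- Shifting by a large multiple `c` of the identity makes all entries of `Q` nonnegative.
  set c : ℝ := ∑ a, |Q a a|
  have hc : ∀ a b, 0 ≤ (t • (Q + c • (1 : Matrix ι ι ℝ))) a b := by
    intro a b
    refine mul_nonneg ht ?_
    rcases eq_or_ne a b with rfl | hab
    · have : |Q a a| ≤ c :=
        Finset.single_le_sum (f := fun a => |Q a a|) (fun a _ => abs_nonneg _) (Finset.mem_univ a)
      simp only [Matrix.add_apply, Matrix.smul_apply, Matrix.one_apply_eq, smul_eq_mul, mul_one]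
      linarith [neg_abs_le (Q a a)]
    · simpa [hab] using hQ a b hab
  let C : AddSubmonoid (Matrix ι ι ℝ) :=
    { carrier := {M | ∀ a b, 0 ≤ M a b}
      zero_mem' := fun a b => le_rfl
      add_mem' := fun hM hN a b => add_nonneg (hM a b) (hN a b) }
  have hC : IsClosed (C : Set (Matrix ι ι ℝ)) := by
    have : (C : Set (Matrix ι ι ℝ)) = ⋂ a, ⋂ b, {M | 0 ≤ M a b} := by
      ext M; simp only [Set.mem_iInter]; rfl
    rw [this]
    exact isClosed_iInter fun a => isClosed_iInter fun b =>
      isClosed_le continuous_const (continuous_id.matrix_elem a b)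
  have hpow : ∀ k : ℕ, (t • (Q + c • (1 : Matrix ι ι ℝ))) ^ k ∈ C := by
    intro k
    induction k with
    | zero =>
      intro a b
      rw [pow_zero, Matrix.one_apply]
      split_ifs <;> norm_num
    | succ k ih =>
      intro a b
      rw [pow_succ, Matrix.mul_apply]
      exact Finset.sum_nonneg fun i _ => mul_nonneg (ih a i) (hc i b)
  have hexp : NormedSpace.exp (t • (Q + c • (1 : Matrix ι ι ℝ))) ∈ C :=
    matrix_exp_mem_of_pow_mem C hC fun k d hd a b => mul_nonneg hd (hpow k a b)
  have hsplit : NormedSpace.exp (t • Q) =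
      NormedSpace.exp (t • (Q + c • (1 : Matrix ι ι ℝ))) *
        NormedSpace.exp (Matrix.diagonal fun _ => -(t * c)) := by
    have hd : (Matrix.diagonal fun _ => -(t * c)) = (-(t * c)) • (1 : Matrix ι ι ℝ) := by
      rw [Matrix.smul_one_eq_diagonal]
    rw [← Matrix.exp_add_of_commute]
    · rw [hd, smul_add, smul_smul, neg_smul, add_neg_cancel_right]
    · rw [hd]
      exact (Commute.one_right _).smul_right _
  rw [hsplit, Matrix.exp_diagonal, Matrix.mul_diagonal]
  refine mul_nonneg (hexp a b) ?_
  rw [Pi.coe_exp, ← Real.exp_eq_exp_ℝ]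
  exact (Real.exp_pos _).le

/-- The semigroup inherits every symmetry of its generator. -/
theorem exp_smul_apply_equiv (Q : Matrix ι ι ℝ) (σ : ι ≃ ι) (hQ : ∀ a b, Q (σ a) (σ b) = Q a b)
    (t : ℝ) (a b : ι) :
    NormedSpace.exp (t • Q) (σ a) (σ b) = NormedSpace.exp (t • Q) a b := by
  let C : AddSubmonoid (Matrix ι ι ℝ) :=
    { carrier := {M | ∀ a b, M (σ a) (σ b) = M a b}
      zero_mem' := fun a b => rfl
      add_mem' := fun hM hN a b => congrArg₂ (· + ·) (hM a b) (hN a b) }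
  have hC : IsClosed (C : Set (Matrix ι ι ℝ)) := by
    have : (C : Set (Matrix ι ι ℝ)) = ⋂ a, ⋂ b, {M | M (σ a) (σ b) = M a b} := by
      ext M; simp only [Set.mem_iInter]; rfl
    rw [this]
    exact isClosed_iInter fun a => isClosed_iInter fun b =>
      isClosed_eq (continuous_id.matrix_elem _ _) (continuous_id.matrix_elem a b)
  have hpow : ∀ k : ℕ, (t • Q) ^ k ∈ C := by
    intro k
    induction k with
    | zero =>
      intro a b
      simp [Matrix.one_apply]
    | succ k ih =>
      intro a b
      rw [pow_succ, Matrix.mul_apply, Matrix.mul_apply, ← σ.sum_comp]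
      refine Finset.sum_congr rfl fun i _ => ?_
      rw [ih a i, Matrix.smul_apply, Matrix.smul_apply, hQ]
  exact matrix_exp_mem_of_pow_mem C hC
    (fun k d _ a b => congrArg (d * ·) (hpow k a b)) a b

/-- The semigroup preserves every subspace that its generator preserves. -/
theorem exp_smul_mulVec_mem (Q : Matrix ι ι ℝ) (V : Submodule ℝ (ι → ℝ))
    (hQ : ∀ f ∈ V, Q *ᵥ f ∈ V) (t : ℝ) {f : ι → ℝ} (hf : f ∈ V) :
    NormedSpace.exp (t • Q) *ᵥ f ∈ V := by
  let C : AddSubmonoid (Matrix ι ι ℝ) :=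
    { carrier := {M | ∀ f ∈ V, M *ᵥ f ∈ V}
      zero_mem' := fun f _ => by rw [Matrix.zero_mulVec]; exact V.zero_mem
      add_mem' := fun hM hN f hf => by
        rw [Matrix.add_mulVec]; exact V.add_mem (hM f hf) (hN f hf) }
  have hC : IsClosed (C : Set (Matrix ι ι ℝ)) := by
    have : (C : Set (Matrix ι ι ℝ)) = ⋂ f ∈ V, (fun M => M *ᵥ f) ⁻¹' (V : Set (ι → ℝ)) := by
      ext M; simp only [Set.mem_iInter]; rfl
    rw [this]
    exact isClosed_biInter fun f _ => V.closed_of_finiteDimensional.preimage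
      (continuous_id.matrix_mulVec continuous_const)
  have hpow : ∀ k : ℕ, (t • Q) ^ k ∈ C := by
    intro k
    induction k with
    | zero =>
      intro f hf
      rwa [pow_zero, Matrix.one_mulVec]
    | succ k ih =>
      intro f hf
      rw [pow_succ, ← Matrix.mulVec_mulVec, Matrix.smul_mulVec]
      exact ih _ (V.smul_mem t (hQ f hf))
  exact matrix_exp_mem_of_pow_mem C hC
    (fun k d _ f hf => by
      rw [Matrix.smul_mulVec]
      exact V.smul_mem d (hpow k f hf)) f hf

theorem exp_smul_mulVec_of_mulVec_eq_zero (Q : Matrix ι ι ℝ) {f : ι → ℝ} (hf : Q *ᵥ f = 0)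
    (t : ℝ) : NormedSpace.exp (t • Q) *ᵥ f = f := by
  funext a
  have h := is_const_of_deriv_eq_zero
    (fun s => (hasDerivAt_exp_smul_mulVec Q f a s).differentiableAt)
    (fun s => by rw [(hasDerivAt_exp_smul_mulVec Q f a s).deriv, hf, Matrix.mulVec_zero]; rfl) t 0
  simpa using h

/-- A function that the generator decreases at relative rate at most `c` decreases at most
exponentially at rate `c` under the semigroup. -/
theorem exp_neg_mul_le_exp_smul_mulVec (Q : Matrix ι ι ℝ) (hQ : ∀ a b, a ≠ b → 0 ≤ Q a b)
    {f : ι → ℝ} {c : ℝ} (hf : ∀ a, 0 ≤ (Q *ᵥ f) a + c * f a) {t : ℝ} (ht : 0 ≤ t) (a : ι) :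
    Real.exp (-(c * t)) * f a ≤ (NormedSpace.exp (t • Q) *ᵥ f) a := by
  have hd : ∀ s, HasDerivAt (fun s : ℝ => Real.exp (c * s) * (NormedSpace.exp (s • Q) *ᵥ f) a)
      (Real.exp (c * s) * (NormedSpace.exp (s • Q) *ᵥ (Q *ᵥ f + c • f)) a) s := by
    intro s
    refine ((((hasDerivAt_id s).const_mul c).exp).mul
      (hasDerivAt_exp_smul_mulVec Q f a s)).congr_deriv ?_
    rw [Matrix.mulVec_add, Matrix.mulVec_smul]
    simp only [Pi.add_apply, Pi.smul_apply, smul_eq_mul, id]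
    ring
  have hmono : MonotoneOn
      (fun s : ℝ => Real.exp (c * s) * (NormedSpace.exp (s • Q) *ᵥ f) a) (Set.Ici 0) := by
    refine monotoneOn_of_deriv_nonneg (convex_Ici 0)
      (fun s _ => (hd s).continuousAt.continuousWithinAt)
      (fun s _ => (hd s).differentiableAt.differentiableWithinAt) fun s hs => ?_
    rw [interior_Ici] at hs
    rw [(hd s).deriv]
    exact mul_nonneg (Real.exp_pos _).le (Finset.sum_nonneg fun b _ =>
      mul_nonneg (exp_smul_nonneg Q hQ (le_of_lt hs) a b) (hf b))
  have h := hmono Set.self_mem_Ici ht ht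
  simp only [mul_zero, Real.exp_zero, one_mul, zero_smul, NormedSpace.exp_zero,
    Matrix.one_mulVec] at h
  rw [Real.exp_neg, inv_mul_le_iff₀ (Real.exp_pos _)]
  exact h

end Semigroup

/-! ### Conservation and decay of the second moment -/

section Decay

variable {n : ℕ} {μ p : ℝ}

/-- The functions that have mean zero over the vertices in every environment. -/
def meanZero (n : ℕ) : Submodule ℝ (State n → ℝ) where
  carrier := {f | ∀ η, ∑ x, f (x, η) = 0}
  zero_mem' := fun η => by simp
  add_mem' := fun {f g} hf hg η => by
    simp only [Pi.add_apply, Finset.sum_add_distrib, hf η, hg η, add_zero]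
  smul_mem' := fun c f hf η => by
    simp only [Pi.smul_apply, smul_eq_mul, ← Finset.mul_sum, hf η, mul_zero]

/-- In a frozen environment the walk is symmetric, so it preserves sums over the vertices; the
environment evolves without regard to the walker. -/
theorem generator_mulVec_mem_meanZero {f : State n → ℝ} (hf : f ∈ meanZero n) :
    generator n μ p *ᵥ f ∈ meanZero n := by
  intro η
  have hf' : ∀ η, ∑ x, f (x, η) = 0 := hf
  have hwalk : ∑ x, ∑ v, 1 / ((n : ℝ) - 1) * (openInd η x v * (f (v, η) - f (x, η))) = 0 := by
    have h := Finset.sum_comm (s := Finset.univ) (t := Finset.univ)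
      (f := fun x v => 1 / ((n : ℝ) - 1) * (openInd η x v * (f (v, η) - f (x, η))))
    have h' : ∑ v, ∑ x, 1 / ((n : ℝ) - 1) * (openInd η x v * (f (v, η) - f (x, η))) =
        -∑ x, ∑ v, 1 / ((n : ℝ) - 1) * (openInd η x v * (f (v, η) - f (x, η))) := by
      simp only [← Finset.sum_neg_distrib]
      refine Finset.sum_congr rfl fun v _ => Finset.sum_congr rfl fun x _ => ?_
      rw [openInd_comm η x v]
      ring
    linarith
  simp only [generator_mulVec, Finset.sum_add_distrib, hwalk, zero_add]
  rw [Finset.sum_comm]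
  refine Finset.sum_eq_zero fun e _ => ?_
  rw [← Finset.mul_sum, Finset.sum_sub_distrib, Finset.sum_add_distrib, ← Finset.mul_sum,
    ← Finset.mul_sum, hf', hf', hf']
  ring

/-- Grönwall: the second moment has derivative `-2` times the Dirichlet form, which the Poincaré
inequality bounds from below because the semigroup stays in `meanZero n`. -/
theorem sum_erExpect_sq_transition_le (hμ : 0 ≤ μ) (hp0 : 0 ≤ p) (hp1 : p ≤ 1)
    (hμn : μ ≤ 1 / ((n : ℝ) - 1)) {f : State n → ℝ} (hf : f ∈ meanZero n) {t : ℝ} (ht : 0 ≤ t) :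
    ∑ x, erExpect n p (fun η => (transition n μ p t *ᵥ f) (x, η) ^ 2) ≤
      Real.exp (-(μ * p * n / 3 * t)) * ∑ x, erExpect n p (fun η => f (x, η) ^ 2) := by
  set κ : ℝ := μ * p * n / 3
  let u : ℝ → State n → ℝ := fun s => transition n μ p s *ᵥ f
  let G : ℝ → ℝ := fun s => ∑ x, erExpect n p (fun η => u s (x, η) ^ 2)
  have hG : ∀ s, HasDerivAt G (-(2 * dirichletForm n μ p (u s))) s := by
    intro s
    have h : HasDerivAt G (∑ x, ∑ η, erdosRenyi n p η *
        (2 * u s (x, η) * (generator n μ p *ᵥ u s) (x, η))) s := by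
      refine HasDerivAt.fun_sum fun x _ => HasDerivAt.fun_sum fun η _ =>
        HasDerivAt.const_mul _ ?_
      have h1 := (hasDerivAt_exp_smul_mulVec (generator n μ p) f (x, η) s).pow 2
      rw [exp_smul_mulVec_comm] at h1
      refine h1.congr_deriv ?_
      simp [u, transition]
    refine h.congr_deriv ?_
    rw [neg_mul_eq_mul_neg, ← sum_erExpect_mul_generator, Finset.mul_sum]
    refine Finset.sum_congr rfl fun x _ => ?_
    rw [← erExpect_const_mul, erExpect]
    exact Finset.sum_congr rfl fun η _ => by ring
  have hH : ∀ s, HasDerivAt (fun s => Real.exp (κ * s) * G s)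
      (Real.exp (κ * s) * (κ * G s - 2 * dirichletForm n μ p (u s))) s := by
    intro s
    refine ((((hasDerivAt_id s).const_mul κ).exp).mul (hG s)).congr_deriv ?_
    simp only [id]
    ring
  have hanti : Antitone (fun s => Real.exp (κ * s) * G s) := by
    refine antitone_of_deriv_nonpos (fun s => (hH s).differentiableAt) fun s => ?_
    rw [(hH s).deriv]
    have hP := poincare hμ hp0 hp1 hμn (u s)
      (exp_smul_mulVec_mem _ (meanZero n) (fun f => generator_mulVec_mem_meanZero) s hf)
    refine mul_nonpos_of_nonneg_of_nonpos (Real.exp_pos _).le ?_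
    simp only [κ, G]
    linarith
  have h := hanti ht
  simp only [mul_zero, Real.exp_zero, one_mul, G, u, transition, zero_smul, NormedSpace.exp_zero,
    Matrix.one_mulVec] at h
  rw [Real.exp_neg, ← div_eq_inv_mul, le_div_iff₀' (Real.exp_pos _)]
  exact h

end Decay

/-! ### The law of the walker -/

section Law

variable {n : ℕ} {μ p : ℝ}

theorem generator_mulVec_one : generator n μ p *ᵥ 1 = 0 := by
  funext ⟨x, η⟩
  simp [generator_mulVec]

theorem transition_mulVec_one (t : ℝ) : transition n μ p t *ᵥ 1 = 1 :=
  exp_smul_mulVec_of_mulVec_eq_zero _ generator_mulVec_one t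

/-- The indicator that the walker is at `x`. -/
noncomputable def atVertex {n : ℕ} (x : Fin n) (b : State n) : ℝ := if b.1 = x then 1 else 0

theorem walkLaw_eq (x₀ : Fin n) (t : ℝ) (x : Fin n) :
    walkLaw n μ p x₀ t x =
      erExpect n p (fun η => (transition n μ p t *ᵥ atVertex x) (x₀, η)) := by
  refine Finset.sum_congr rfl fun η₀ _ => ?_
  simp only [Matrix.mulVec, dotProduct, atVertex, mul_ite, mul_one, mul_zero,
    Fintype.sum_prod_type_right, Finset.sum_ite_eq', Finset.mem_univ, if_true]

theorem sum_walkLaw (x₀ : Fin n) (t : ℝ) : ∑ x, walkLaw n μ p x₀ t x = 1 := by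
  have h1 : ∑ x : Fin n, atVertex x = 1 := by
    funext b
    simp [atVertex]
  simp only [walkLaw_eq, ← erExpect_sum]
  rw [← erExpect_const (n := n) (p := p) 1]
  congr 1
  funext η
  rw [← Finset.sum_apply, ← Matrix.mulVec_sum, h1, transition_mulVec_one]
  rfl

/-- The action of a permutation of the vertices on the edges. -/
def edgePerm (σ : Equiv.Perm (Fin n)) : Edge n ≃ Edge n :=
  (SimpleGraph.Iso.completeGraph σ).mapEdgeSet

/-- The action of a permutation of the vertices on the environments. -/
def envPerm (σ : Equiv.Perm (Fin n)) : Env n ≃ Env n :=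
  (edgePerm σ).arrowCongr (Equiv.refl Bool)

/-- The action of a permutation of the vertices on the states. -/
def statePerm (σ : Equiv.Perm (Fin n)) : State n ≃ State n := σ.prodCongr (envPerm σ)

theorem envPerm_apply_edgePerm (σ : Equiv.Perm (Fin n)) (η : Env n) (e : Edge n) :
    envPerm σ η (edgePerm σ e) = η e := by
  simp [envPerm]

theorem envPerm_update (σ : Equiv.Perm (Fin n)) (η : Env n) (e : Edge n) (b : Bool) :
    envPerm σ (Function.update η e b) = Function.update (envPerm σ η) (edgePerm σ e) b := by
  funext e'
  obtain ⟨e', rfl⟩ := (edgePerm σ).surjective e'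
  rw [envPerm_apply_edgePerm]
  rcases eq_or_ne e' e with rfl | h
  · simp
  · rw [Function.update_of_ne h, Function.update_of_ne ((edgePerm σ).injective.ne h),
      envPerm_apply_edgePerm]

theorem walkerAfter_perm (σ : Equiv.Perm (Fin n)) (η : Env n) (x v : Fin n) :
    walkerAfter (envPerm σ η) (σ x) (σ v) = σ (walkerAfter η x v) := by
  unfold walkerAfter
  by_cases h : x = v
  · rw [dif_neg (not_not.2 h), dif_neg (not_not.2 (congrArg σ h))]
  · have he : edge (σ x) (σ v) (σ.injective.ne h) = edgePerm σ (edge x v h) := rfl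
    rw [dif_pos h, dif_pos (σ.injective.ne h), he, envPerm_apply_edgePerm]
    split_ifs <;> rfl

theorem pointMass_perm (σ : Equiv.Perm (Fin n)) (a b : State n) :
    pointMass (statePerm σ a) (statePerm σ b) = pointMass a b := by
  simp [pointMass]

theorem generator_perm (σ : Equiv.Perm (Fin n)) (a b : State n) :
    generator n μ p (statePerm σ a) (statePerm σ b) = generator n μ p a b := by
  obtain ⟨x, η⟩ := a
  simp only [generator, Matrix.of_apply]
  congr 1
  · symm
    refine Finset.sum_equiv σ (fun v => by simp [statePerm]) fun v _ => ?_
    rw [pointMass_perm]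
    congr 2
    rw [← pointMass_perm σ]
    congr 1
    exact Prod.ext (walkerAfter_perm σ η x v).symm rfl
  · symm
    refine Fintype.sum_equiv (edgePerm σ) _ _ fun e => ?_
    have h : ∀ c, ((statePerm σ (x, η)).1,
        Function.update (statePerm σ (x, η)).2 (edgePerm σ e) c) =
        statePerm σ (x, Function.update η e c) :=
      fun c => Prod.ext rfl (envPerm_update σ η e c).symm
    simp only [h, pointMass_perm]

theorem erdosRenyi_perm (σ : Equiv.Perm (Fin n)) (η : Env n) :
    erdosRenyi n p (envPerm σ η) = erdosRenyi n p η := by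
  rw [erdosRenyi, ← (edgePerm σ).prod_comp]
  simp only [envPerm_apply_edgePerm]
  rfl

theorem walkLaw_perm (σ : Equiv.Perm (Fin n)) (x₀ : Fin n) (t : ℝ) (x : Fin n) :
    walkLaw n μ p (σ x₀) t (σ x) = walkLaw n μ p x₀ t x := by
  rw [walkLaw, ← (envPerm σ).sum_comp]
  refine Finset.sum_congr rfl fun η₀ _ => ?_
  rw [erdosRenyi_perm, ← (envPerm σ).sum_comp]
  congr 1
  exact Finset.sum_congr rfl fun η _ =>
    exp_smul_apply_equiv (generator n μ p) (statePerm σ) (generator_perm σ) t (x₀, η₀) (x, η)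

/-- By symmetry, the law of the walker is uniform off its starting point, so its distance from
uniform is determined by the return probability. -/
theorem tvDist_walkLaw (x₀ : Fin n) (t : ℝ) :
    tvDist (walkLaw n μ p x₀ t) (uniformLaw n) = |walkLaw n μ p x₀ t x₀ - 1 / n| := by
  set q := walkLaw n μ p x₀ t
  have hn : (n : ℝ) ≠ 0 := Nat.cast_ne_zero.2 (Fin.pos x₀).ne'
  have hzero : ∑ x, (q x - 1 / n) = 0 := by
    rw [Finset.sum_sub_distrib, sum_walkLaw]
    simp [hn]
  have hconst : ∀ x ∈ Finset.univ.erase x₀, ∀ y ∈ Finset.univ.erase x₀, q x = q y := by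
    intro x hx y hy
    have h := walkLaw_perm (μ := μ) (p := p) (Equiv.swap x y) x₀ t x
    rw [Equiv.swap_apply_of_ne_of_ne (Finset.ne_of_mem_erase hx).symm
      (Finset.ne_of_mem_erase hy).symm, Equiv.swap_apply_left] at h
    exact h.symm
  have habs : ∑ x ∈ Finset.univ.erase x₀, |q x - 1 / n| =
      |∑ x ∈ Finset.univ.erase x₀, (q x - 1 / n)| := by
    rcases (Finset.univ.erase x₀).eq_empty_or_nonempty with h | ⟨y, hy⟩
    · simp [h]
    · rw [Finset.sum_congr (g := fun _ => |q y - 1 / n|) rfl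
          fun x hx => by rw [hconst x hx y hy],
        Finset.sum_congr (f := fun x => q x - 1 / n) (g := fun _ => q y - 1 / n) rfl
          fun x hx => by rw [hconst x hx y hy]]
      simp only [Finset.sum_const, nsmul_eq_mul, abs_mul, Nat.abs_cast]
  rw [← Finset.add_sum_erase _ _ (Finset.mem_univ x₀)] at hzero
  unfold tvDist uniformLaw
  rw [← Finset.add_sum_erase _ _ (Finset.mem_univ x₀), habs, eq_neg_of_add_eq_zero_right hzero,
    abs_neg]
  ring

/-- Exponential convergence to uniform at rate of order `μ p n`, with no prefactor. -/
theorem tvDist_walkLaw_le (hμ : 0 ≤ μ) (hp0 : 0 ≤ p) (hp1 : p ≤ 1) (hμn : μ ≤ 1 / ((n : ℝ) - 1))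
    (x₀ : Fin n) {t : ℝ} (ht : 0 ≤ t) :
    tvDist (walkLaw n μ p x₀ t) (uniformLaw n) ≤ Real.exp (-(μ * p * n / 6 * t)) := by
  have hn : (0 : ℝ) < n := Nat.cast_pos.2 (Fin.pos x₀)
  let f : State n → ℝ := atVertex x₀ - (1 / (n : ℝ)) • 1
  have hf : f ∈ meanZero n := by
    intro η
    simp [f, atVertex, Finset.sum_sub_distrib, hn.ne']
  -- The squared norm at time `0` is the variance `1 - 1 / n` of a point mass, whence no prefactor.
  have hinit : ∑ x, erExpect n p (fun η => f (x, η) ^ 2) ≤ 1 := by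
    rw [← erExpect_sum, ← erExpect_const (n := n) (p := p) 1]
    refine erExpect_mono hp0 hp1 fun η => ?_
    have h : ∀ x, f (x, η) ^ 2 = (1 - 2 / n) * (if x = x₀ then 1 else 0) + (1 / (n : ℝ)) ^ 2 := by
      intro x
      simp only [f, atVertex, Pi.sub_apply, Pi.smul_apply, Pi.one_apply, smul_eq_mul]
      split_ifs <;> ring
    simp only [h, Finset.sum_add_distrib, ← Finset.mul_sum]
    simp only [Finset.sum_ite_eq', Finset.mem_univ, if_true, Finset.sum_const, Finset.card_univ,
      Fintype.card_fin, nsmul_eq_mul]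
    have : (n : ℝ) * (1 / n) ^ 2 = 1 / n := by field_simp
    rw [this]
    have : 0 < 1 / (n : ℝ) := by positivity
    have h2 : 2 / (n : ℝ) = 2 * (1 / n) := by ring
    linarith
  let u : Fin n → Env n → ℝ := fun x η => (transition n μ p t *ᵥ f) (x, η)
  have hu : walkLaw n μ p x₀ t x₀ - 1 / n = erExpect n p (u x₀) := by
    have h : ∀ η, u x₀ η = (transition n μ p t *ᵥ atVertex x₀) (x₀, η) + -(1 / (n : ℝ)) := by
      intro η
      simp only [u, f, Matrix.mulVec_sub, Matrix.mulVec_smul, transition_mulVec_one]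
      simp [sub_eq_add_neg]
    rw [walkLaw_eq, funext h, erExpect_add, erExpect_const, sub_eq_add_neg]
  have hsqnn : ∀ x, 0 ≤ erExpect n p (fun η => u x η ^ 2) := fun x => by
    have h := erExpect_mono hp0 hp1 (fun η => sq_nonneg (u x η))
    rwa [erExpect_const] at h
  -- Jensen's inequality for the square.
  have hvar : erExpect n p (u x₀) ^ 2 ≤ erExpect n p (fun η => u x₀ η ^ 2) := by
    set m := erExpect n p (u x₀)
    have h := erExpect_mono hp0 hp1 (F := fun η => 2 * m * u x₀ η + -m ^ 2)
      (G := fun η => u x₀ η ^ 2) fun η => by nlinarith [sq_nonneg (u x₀ η - m)]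
    rw [erExpect_add, erExpect_const_mul, erExpect_const] at h
    nlinarith
  have hdecay := sum_erExpect_sq_transition_le hμ hp0 hp1 hμn hf ht
  rw [tvDist_walkLaw, hu]
  refine abs_le_of_sq_le_sq ?_ (Real.exp_pos _).le
  calc erExpect n p (u x₀) ^ 2 ≤ erExpect n p (fun η => u x₀ η ^ 2) := hvar
    _ ≤ ∑ x, erExpect n p (fun η => u x η ^ 2) :=
        Finset.single_le_sum (fun x _ => hsqnn x) (Finset.mem_univ x₀)
    _ ≤ Real.exp (-(μ * p * n / 3 * t)) * 1 :=
        hdecay.trans (mul_le_mul_of_nonneg_left hinit (Real.exp_pos _).le)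
    _ = Real.exp (-(μ * p * n / 6 * t)) ^ 2 := by
        rw [mul_one, ← Real.exp_nat_mul]
        congr 1
        push_cast
        ring

end Law

/-! ### The walker isolated at its starting point -/

section Isolated

variable {n : ℕ} {μ p : ℝ}

theorem generator_nonneg_of_ne (hμ : 0 ≤ μ) (hp0 : 0 ≤ p) (hp1 : p ≤ 1) (a b : State n)
    (hab : a ≠ b) : 0 ≤ generator n μ p a b := by
  have hn : (1 : ℝ) ≤ n := Nat.one_le_cast.2 (Fin.pos a.1)
  have hpm : ∀ c, 0 ≤ pointMass c b := fun c => by unfold pointMass; split_ifs <;> norm_num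
  have h0 : pointMass a b = 0 := if_neg hab.symm
  have hk : 0 ≤ 1 / ((n : ℝ) - 1) := one_div_nonneg.2 (by linarith)
  have hq : 0 ≤ 1 - p := by linarith
  simp only [generator, Matrix.of_apply, h0, sub_zero]
  refine add_nonneg (Finset.sum_nonneg fun v _ => mul_nonneg hk (hpm _))
    (Finset.sum_nonneg fun e _ => mul_nonneg hμ ?_)
  exact add_nonneg (mul_nonneg hp0 (hpm _)) (mul_nonneg hq (hpm _))

open Classical in
/-- The indicator that the walker is at `x` and all edges at `x` are closed. -/
noncomputable def isolatedAt {n : ℕ} (x : Fin n) (b : State n) : ℝ :=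
  if b.1 = x ∧ ∀ e : Edge n, x ∈ e.1 → b.2 e = false then 1 else 0

theorem isolatedAt_nonneg (x : Fin n) (b : State n) : 0 ≤ isolatedAt x b := by
  unfold isolatedAt; split_ifs <;> norm_num

theorem isolatedAt_le_atVertex (x : Fin n) (b : State n) : isolatedAt x b ≤ atVertex x b := by
  unfold isolatedAt atVertex
  split_ifs with h h' <;> first | exact absurd h.1 h' | norm_num

theorem card_incident_le (x : Fin n) [DecidablePred fun e : Edge n => x ∈ e.1] :
    (Finset.univ.filter fun e : Edge n => x ∈ e.1).card ≤ n := by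
  have hsub : (Finset.univ.filter fun e : Edge n => x ∈ e.1) ⊆
      Finset.univ.image fun v : {v // x ≠ v} => edge x v v.2 := by
    rintro ⟨e, he⟩ hx
    obtain ⟨v, rfl⟩ := Sym2.mem_iff_exists.1 (Finset.mem_filter.1 hx).2
    exact Finset.mem_image.2 ⟨⟨v, by simpa using he⟩, Finset.mem_univ _, rfl⟩
  refine (Finset.card_le_card hsub).trans (Finset.card_image_le.trans ?_)
  exact (Fintype.card_subtype_le _).trans_eq (Fintype.card_fin n)

/-- An isolated walker can only lose its isolation by one of its at most `n` edges being refreshed to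
open, which happens at total rate at most `μ p n`. -/
theorem generator_mulVec_isolatedAt (hμ : 0 ≤ μ) (hp0 : 0 ≤ p) (hp1 : p ≤ 1) (x : Fin n)
    (b : State n) :
    0 ≤ (generator n μ p *ᵥ isolatedAt x) b + μ * (p * n) * isolatedAt x b := by
  classical
  obtain ⟨y, η⟩ := b
  have hn : (1 : ℝ) ≤ n := Nat.one_le_cast.2 (Fin.pos x)
  have hk : 0 ≤ 1 / ((n : ℝ) - 1) := one_div_nonneg.2 (by linarith)
  have hq : 0 ≤ 1 - p := by linarith
  rw [generator_mulVec]
  by_cases hb : y = x ∧ ∀ e : Edge n, x ∈ e.1 → η e = false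
  · obtain ⟨rfl, hη⟩ := hb
    have h1 : isolatedAt y (y, η) = 1 := if_pos ⟨rfl, hη⟩
    have hopen : ∀ v, openInd η y v = 0 := by
      intro v
      unfold openInd
      split_ifs with h h'
      · rw [hη _ (by simp [edge])] at h'
        exact absurd h' Bool.false_ne_true
      · rfl
      · rfl
    have hfalse : ∀ e : Edge n, isolatedAt y (y, Function.update η e false) = 1 := fun e =>
      if_pos ⟨rfl, fun e' he' => by
        rcases eq_or_ne e' e with rfl | h
        · simp
        · simpa [Function.update_of_ne h] using hη e' he'⟩
    have htrue : ∀ e : Edge n, -(if y ∈ e.1 then 1 else 0) ≤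
        isolatedAt y (y, Function.update η e true) - 1 := by
      intro e
      split_ifs with h
      · linarith [isolatedAt_nonneg y (y, Function.update η e true)]
      · have : isolatedAt y (y, Function.update η e true) = 1 :=
          if_pos ⟨rfl, fun e' he' => by
            have hne : e' ≠ e := fun h' => h (h' ▸ he')
            simpa [Function.update_of_ne hne] using hη e' he'⟩
        rw [this]
        norm_num
    have hcard : (∑ e : Edge n, if y ∈ e.1 then (1 : ℝ) else 0) ≤ n := by
      rw [Finset.sum_boole]
      exact_mod_cast card_incident_le y
    have hsum : -(μ * p * n) ≤ ∑ e : Edge n,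
        μ * (p * isolatedAt y (y, Function.update η e true) + (1 - p) * 1 - 1) := by
      calc -(μ * p * n) ≤ μ * p * ∑ e : Edge n, -(if y ∈ e.1 then (1 : ℝ) else 0) := by
            rw [Finset.sum_neg_distrib, mul_neg]
            exact neg_le_neg (mul_le_mul_of_nonneg_left hcard (by positivity))
        _ ≤ _ := by
            rw [Finset.mul_sum]
            refine Finset.sum_le_sum fun e _ => ?_
            calc μ * p * -(if y ∈ e.1 then (1 : ℝ) else 0)
                ≤ μ * p * (isolatedAt y (y, Function.update η e true) - 1) :=
                  mul_le_mul_of_nonneg_left (htrue e) (by positivity)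
              _ = _ := by ring
    simp only [hopen, hfalse, h1, zero_mul, mul_zero, Finset.sum_const_zero, zero_add]
    linarith
  · have h0 : isolatedAt x (y, η) = 0 := if_neg hb
    simp only [h0, sub_zero, mul_zero, add_zero]
    refine add_nonneg
      (Finset.sum_nonneg fun v _ => mul_nonneg hk (mul_nonneg (openInd_nonneg η y v) ?_))
      (Finset.sum_nonneg fun e _ => mul_nonneg hμ (add_nonneg (mul_nonneg hp0 ?_)
        (mul_nonneg hq ?_))) <;> exact isolatedAt_nonneg _ _

theorem pow_le_erExpect_isolatedAt (hp0 : 0 ≤ p) (hp1 : p ≤ 1) (x : Fin n) :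
    (1 - p) ^ n ≤ erExpect n p (fun η => isolatedAt x (x, η)) := by
  classical
  have hq : 0 ≤ 1 - p := by linarith
  let g : Edge n → Bool → ℝ := fun e b => if x ∈ e.1 ∧ b = true then 0 else 1
  have hg : ∀ η : Env n, isolatedAt x (x, η) = ∏ e, g e (η e) := by
    intro η
    unfold isolatedAt
    split_ifs with h
    · refine (Finset.prod_eq_one fun e _ => if_neg fun he => ?_).symm
      exact Bool.false_ne_true ((h.2 e he.1).symm.trans he.2)
    · have : ∃ e : Edge n, x ∈ e.1 ∧ η e = true := by
        by_contra! hcon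
        exact h ⟨rfl, fun e he => by simpa using hcon e he⟩
      obtain ⟨e, he⟩ := this
      exact (Finset.prod_eq_zero (f := fun e => g e (η e)) (Finset.mem_univ e) (if_pos he)).symm
  have hterm : ∀ e : Edge n, p * g e true + (1 - p) * g e false =
      if x ∈ e.1 then 1 - p else 1 := by
    intro e
    by_cases h : x ∈ e.1 <;> simp [g, h]
  simp only [hg, erExpect_prod, hterm]
  rw [← Finset.prod_filter, Finset.prod_const]
  exact pow_le_pow_of_le_one hq (by linarith) (card_incident_le x)

/-- The walker is still at its starting point if no edge there was open initially and none has been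
refreshed to open since. -/
theorem exp_mul_pow_le_walkLaw (hμ : 0 ≤ μ) (hp0 : 0 ≤ p) (hp1 : p ≤ 1) (x : Fin n) {t : ℝ}
    (ht : 0 ≤ t) :
    Real.exp (-(μ * (p * n) * t)) * (1 - p) ^ n ≤ walkLaw n μ p x t x := by
  rw [walkLaw_eq]
  refine (mul_le_mul_of_nonneg_left (pow_le_erExpect_isolatedAt hp0 hp1 x)
    (Real.exp_pos _).le).trans ?_
  rw [← erExpect_const_mul]
  refine erExpect_mono hp0 hp1 fun η => ?_
  have hQ := generator_nonneg_of_ne (n := n) hμ hp0 hp1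
  exact (exp_neg_mul_le_exp_smul_mulVec _ hQ
    (generator_mulVec_isolatedAt hμ hp0 hp1 x) ht (x, η)).trans
    (Finset.sum_le_sum fun b _ => mul_le_mul_of_nonneg_left (isolatedAt_le_atVertex x b)
      (exp_smul_nonneg _ hQ ht (x, η) b))

end Isolated

/-! ### Mixing time bounds -/

/-- At time `log (1 / ε) / (2 λ μ)` the survival factor `exp (-λ μ t)` is `√ε`, and
`√ε * exp (-λ) > ε` as soon as `ε < exp (-2 λ)`. -/
theorem eventually_lower_bound {lam ε : ℝ} (hε : 0 < ε) (hlt : ε < Real.exp (-3 * lam))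
    (hlam : 0 < lam) :
    ∀ᶠ n : ℕ in Filter.atTop,
      ε ≤ Real.exp (-(1 / 2 * Real.log (1 / ε))) * (1 - lam / n) ^ n - 1 / n := by
  have hlog : Real.log ε < -3 * lam := (Real.log_lt_iff_lt_exp hε).2 hlt
  have hlim : Filter.Tendsto
      (fun n : ℕ => Real.exp (-(1 / 2 * Real.log (1 / ε))) * (1 - lam / n) ^ n - 1 / n)
      Filter.atTop (nhds (Real.exp (-(1 / 2 * Real.log (1 / ε))) * Real.exp (-lam) - 0)) := by
    refine (Filter.Tendsto.const_mul _ ?_).sub tendsto_one_div_atTop_nhds_zero_nat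
    refine (Real.tendsto_one_add_div_pow_exp (-lam)).congr fun n => ?_
    rw [neg_div, sub_eq_add_neg]
  refine (hlim.eventually_const_lt ?_).mono fun n hn => le_of_lt hn
  rw [sub_zero, ← Real.exp_add]
  nth_rewrite 1 [← Real.exp_log hε]
  rw [Real.exp_lt_exp, one_div ε, Real.log_inv]
  linarith

end DynamicalER

/-- The vertex `1` is `(0 : Fin n)`. -/
theorem mainTheorem3 :
    ∀ lam : ℝ, 0 < lam → ∃ C : ℝ, 0 < C ∧
      ∀ ε : ℝ, 0 < ε → ε < 1 → ∃ N : ℕ, ∀ (n : ℕ) [NeZero n], N ≤ n →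
        ∀ μ : ℝ, 0 < μ →
          (ε < min (Real.exp (-3 * lam)) 1 →
            ENNReal.ofReal (1 / μ * (1 / (2 * lam) * Real.log (1 / ε))) ≤
              DynamicalER.tMixRW n μ (lam / n) 0 ε) ∧
          (ε < 1 / 4 → μ ≤ 2 / 3 * (1 + lam)⁻¹ / n →
            DynamicalER.tMixRW n μ (lam / n) 0 ε ≤
              ENNReal.ofReal (1 / μ * (C * Real.log (1 / ε)))) := by
  intro lam hlam
  refine ⟨6 / lam, by positivity, fun ε hε0 hε1 => ?_⟩
  obtain ⟨N, hN⟩ : ∃ N : ℕ, ∀ n, N ≤ n → ε < Real.exp (-3 * lam) →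
      ε ≤ Real.exp (-(1 / 2 * Real.log (1 / ε))) * (1 - lam / n) ^ n - 1 / n := by
    by_cases h : ε < Real.exp (-3 * lam)
    · obtain ⟨N, hN⟩ := Filter.eventually_atTop.1
        (DynamicalER.eventually_lower_bound hε0 h hlam)
      exact ⟨N, fun n hn _ => hN n hn⟩
    · exact ⟨0, fun n _ h' => absurd h' h⟩
  refine ⟨max N (max 2 ⌈lam⌉₊), fun n _ hn μ hμ => ?_⟩
  have hn2 : (2 : ℝ) ≤ n := by exact_mod_cast (le_max_left _ _).trans ((le_max_right _ _).trans hn)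
  have hn0 : (0 : ℝ) < n := by linarith
  have hlamn : lam ≤ n :=
    Nat.ceil_le.1 ((le_max_right _ _).trans ((le_max_right _ _).trans hn))
  have hp0 : 0 ≤ lam / n := by positivity
  have hp1 : lam / n ≤ 1 := (div_le_one hn0).2 hlamn
  have hpn : lam / n * n = lam := div_mul_cancel₀ _ hn0.ne'
  have hlog : 0 < Real.log (1 / ε) := Real.log_pos (one_lt_one_div hε0 hε1)
  refine ⟨fun hlt => ?_, fun _ hμn => ?_⟩
  · have ht : 0 ≤ 1 / μ * (1 / (2 * lam) * Real.log (1 / ε)) := by positivity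
    refine le_iSup₂_of_le _ ⟨ht, ?_⟩ le_rfl
    have hq := DynamicalER.exp_mul_pow_le_walkLaw hμ.le hp0 hp1 (0 : Fin n) ht
    have harg : μ * (lam / n * n) * (1 / μ * (1 / (2 * lam) * Real.log (1 / ε))) =
        1 / 2 * Real.log (1 / ε) := by
      rw [hpn]
      field_simp
    rw [harg] at hq
    rw [DynamicalER.tvDist_walkLaw]
    refine le_trans ?_ (le_abs_self _)
    linarith [hN n ((le_max_left _ _).trans hn) (hlt.trans_le (min_le_left _ _))]
  · have hμn' : μ ≤ 1 / ((n : ℝ) - 1) := by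
      have h1 : (1 + lam)⁻¹ ≤ 1 := inv_le_one_of_one_le₀ (by linarith)
      calc μ ≤ 2 / 3 * (1 + lam)⁻¹ / n := hμn
        _ ≤ 1 / n := by gcongr; linarith
        _ ≤ 1 / ((n : ℝ) - 1) := one_div_le_one_div_of_le (by linarith) (by linarith)
    refine iSup₂_le fun t ht => ENNReal.ofReal_le_ofReal ?_
    have hle := ht.2.trans (DynamicalER.tvDist_walkLaw_le hμ.le hp0 hp1 hμn' (0 : Fin n) ht.1)
    rw [mul_assoc μ, hpn, ← Real.log_le_iff_le_exp hε0] at hle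
    have hlogε : Real.log (1 / ε) = -Real.log ε := by rw [one_div, Real.log_inv]
    have h6 : μ * lam * t ≤ 6 * Real.log (1 / ε) := by linarith
    calc t = 1 / μ * (1 / lam * (μ * lam * t)) := by field_simp
      _ ≤ 1 / μ * (1 / lam * (6 * Real.log (1 / ε))) := by gcongr
      _ = 1 / μ * (6 / lam * Real.log (1 / ε)) := by ring
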